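/- A graph $G$ is *set-sequential* if, for some $n$, its vertices can be labeled with distinct nonzero vectors of $\mathbb{F}_2^n$ such that, when each edge is labeled with the sum (in $\mathbb{F}_2^n$) of the labels of its two endpoints, every nonzero vector of $\mathbb{F}_2^n$ is used exactly once as a label of either a vertex or an edge. A *caterpillar* is a finite tree containing some path (possibly consisting of a single vertex) from which every vertex has distance at most $1$. The *diameter* of a connected graph is the largest distance between two of its vertices. **Theorem.** For every integer $k \ge 0$, every caterpillar of diameter $k+1$ in which all vertices have odd degree, and which has at least $2^k$ vertices and exactly $2^n$ vertices in total for some integer $n\ge 0$, is set-sequential. -/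

import Mathlib

namespace SimpleGraph

variable {V : Type*}

/-- A caterpillar: a tree containing a path (the center path, possibly a single vertex) from which
every vertex has distance at most `1`. -/
def IsCaterpillar (G : SimpleGraph V) : Prop :=
  G.IsTree ∧ ∃ (u v : V) (p : G.Walk u v), p.IsPath ∧ ∀ w : V, ∃ x ∈ p.support, G.dist w x ≤ 1

/-- The label of an edge induced by a vertex labeling: the sum of the labels of its endpoints. -/
def edgeSumLabel {A : Type*} [AddCommMonoid A] (f : V → A) (e : Sym2 V) : A :=
  Sym2.lift ⟨fun a b => f a + f b, fun a b => add_comm (f a) (f b)⟩ e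

/-- The labeling of the vertices and edges of `G` induced by a vertex labeling. -/
def inducedLabeling {A : Type*} [AddCommMonoid A] (G : SimpleGraph V) (f : V → A) :
    V ⊕ G.edgeSet → A :=
  Sum.elim f (fun e => edgeSumLabel f (e : Sym2 V))

/-- A graph is set-sequential if, for some `n`, its vertices can be labeled with distinct nonzero
vectors of `𝔽₂ⁿ` such that, when each edge is labeled with the sum of its endpoints, every nonzero
vector of `𝔽₂ⁿ` is the label of exactly one element of the union of the vertices and the edges. -/
def IsSetSequential (G : SimpleGraph V) : Prop :=
  ∃ (n : ℕ) (f : V → (Fin n → ZMod 2)),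
    Function.Injective f ∧ (∀ v : V, f v ≠ 0) ∧
      ∀ x : Fin n → ZMod 2, x ≠ 0 → ∃! a : V ⊕ G.edgeSet, inducedLabeling G f a = x

end SimpleGraph

/-!
A set-sequential labeling of a tree `T` with `2 ^ n` vertices partitions `𝔽₂ⁿ⁺¹` into pairs. Root
`T` at a vertex `s` with label `f s`. Each vertex `w ≠ s` gives the pair formed by its label and
the label of the edge to its parent, whose difference is the label of the parent, and the root gives
the pair `{0, f s}`. Conversely, let the non-leaves of a caterpillar, which form a path called the
spine, be labeled by basis vectors. Then a labeling of the leaves can be read off from a perfect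
matching of the cube of dimension `n + 1` in which the number of edges in the direction of `f v` is
the number of children of `v` (one more at the root) and which contains the pairs belonging to the
root and to the spine vertices (`isSetSequential_of_matching`). There are enough basis vectors
because the spine has at most `n` vertices. All the prescribed numbers are even because all degrees
are odd (`SimpleGraph.IsTree.card_fiber_parent`).

Vertices of the cube are finite sets, addition is symmetric difference, and a matching is given by
the direction of the edge at each vertex. Two constructions produce such matchings.

* `exists_realizes`: if nothing is prescribed but the direction counts, every even vector of counts
  with the right sum is attained. By induction on the dimension: a direction `i` cuts the cube into
  two facets, which are matched separately; wherever the two matchings have parallel edges, these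
  two edges can be replaced by two edges in direction `i`. If `i` is to be used by no edges, nothing
  needs to be replaced; if by two, translating one of the matchings makes one pair of edges
  parallel; and if every direction is to be used at least four times, `i` is taken to be the most
  frequent one and both facets get the same matching.

* `exists_realizes_of_tree`: order the spine vertices `0, 1, …` such that every vertex comes after
  its parent. The facet of the cube on `0, …, t` that contains `t` contains only one of the
  prescribed edges, namely the one at `{t}`, in the direction of the parent of `t`. A matching of
  this facet that uses this direction can be translated to contain this edge. So the facets are
  matched independently, and only the distribution of the direction counts over the facets remains.
  It is possible if the partial sums of the counts grow fast enough, and they do if the root has the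
  largest degree on the spine (`exists_spine_matching`).
-/

open Finset symmDiff

/-! ### Perfect matchings of cubes -/

section CubeMatching

variable {ι : Type*} [DecidableEq ι]

/-- A perfect matching of the cube of all subsets of `S`, in which `x` and `y` are adjacent when
they differ by one element. The matching is encoded by the direction `D x` of the edge at each
vertex `x`: the partner of `x` is `x ∆ {D x}`. Values of `D` off the cube are irrelevant. -/
structure IsCubeMatching (S : Finset ι) (D : Finset ι → ι) : Prop where
  mem : ∀ x ⊆ S, D x ∈ S
  symm : ∀ x ⊆ S, D (x ∆ {D x}) = D x

/-- The number of vertices of the cube on `S` that are matched in direction `i`, that is, twice the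
number of edges in direction `i`. -/
def directionCount (S : Finset ι) (D : Finset ι → ι) (i : ι) : ℕ :=
  #{x ∈ S.powerset | D x = i}

/-- `D` is a perfect matching of the cube on `S` with exactly `2 * a i` edges in each
direction `i`. -/
def Realizes (S : Finset ι) (D : Finset ι → ι) (a : ι → ℕ) : Prop :=
  IsCubeMatching S D ∧ ∀ i, directionCount S D i = 4 * a i

theorem symmDiff_singleton_subset {S x : Finset ι} {i : ι} (hx : x ⊆ S) (hi : i ∈ S) :
    x ∆ {i} ⊆ S := by
  intro j hj
  simp only [mem_symmDiff, mem_singleton] at hj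
  rcases hj with h | h
  · exact hx h.1
  · exact h.1 ▸ hi

theorem directionCount_eq_sum (S : Finset ι) (D : Finset ι → ι) (i : ι) :
    directionCount S D i = ∑ x ∈ S.powerset, if D x = i then 1 else 0 := by
  rw [directionCount, card_filter]

theorem directionCount_eq_zero {S : Finset ι} {D : Finset ι → ι} (hD : IsCubeMatching S D) {i : ι}
    (hi : i ∉ S) : directionCount S D i = 0 := by
  rw [directionCount, card_eq_zero, filter_eq_empty_iff]
  intro x hx h
  exact hi (h ▸ hD.mem x (mem_powerset.1 hx))

/-- Exactly half of the vertices matched in direction `i` do not contain `i`. -/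
theorem two_mul_card_filter_notMem {S : Finset ι} {D : Finset ι → ι} (hD : IsCubeMatching S D)
    (i : ι) : 2 * #{x ∈ S.powerset | D x = i ∧ i ∉ x} = directionCount S D i := by
  have h1 : #{x ∈ S.powerset | D x = i ∧ i ∈ x} = #{x ∈ S.powerset | D x = i ∧ i ∉ x} := by
    refine card_bij' (fun x _ => x ∆ {i}) (fun x _ => x ∆ {i}) ?_ ?_ ?_ ?_
    · intro x hx
      simp only [mem_filter, mem_powerset] at hx ⊢
      obtain ⟨hxS, rfl, hix⟩ := hx
      refine ⟨symmDiff_singleton_subset hxS (hD.mem x hxS), hD.symm x hxS, ?_⟩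
      simp [mem_symmDiff, hix]
    · intro x hx
      simp only [mem_filter, mem_powerset] at hx ⊢
      obtain ⟨hxS, rfl, hix⟩ := hx
      refine ⟨symmDiff_singleton_subset hxS (hD.mem x hxS), hD.symm x hxS, ?_⟩
      simp [mem_symmDiff, hix]
    · intro x _
      exact symmDiff_symmDiff_cancel_right _ _
    · intro x _
      exact symmDiff_symmDiff_cancel_right _ _
  have h2 := card_filter_add_card_filter_not (s := {x ∈ S.powerset | D x = i}) (fun x => i ∈ x)
  rw [filter_filter, filter_filter] at h2
  rw [directionCount]
  omega

/-- Matchings of the two facets `i ∉ x` and `i ∈ x` of the cube on `insert i S`, with the edges at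
the vertices in `F` replaced by edges in direction `i`. -/
def crossMatching (i : ι) (D₁ D₂ : Finset ι → ι) (F : Finset (Finset ι)) (x : Finset ι) : ι :=
  if x.erase i ∈ F then i else if i ∈ x then D₂ (x.erase i) else D₁ (x.erase i)

/-- Rerouting through direction `i` is possible wherever the matchings of the two facets have
parallel edges. -/
theorem IsCubeMatching.cross {S : Finset ι} {i : ι} {D₁ D₂ : Finset ι → ι}
    (h₁ : IsCubeMatching S D₁) (h₂ : IsCubeMatching S D₂) (hi : i ∉ S) {F : Finset (Finset ι)}
    (hF : ∀ x ∈ F, D₁ x = D₂ x ∧ x ∆ {D₁ x} ∈ F) :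
    IsCubeMatching (insert i S) (crossMatching i D₁ D₂ F) := by
  have key : ∀ x ⊆ insert i S, x.erase i ⊆ S := fun x hx => by
    rwa [← subset_insert_iff]
  constructor
  · intro x hx
    unfold crossMatching
    split_ifs
    · exact mem_insert_self _ _
    · exact mem_insert_of_mem (h₂.mem _ (key x hx))
    · exact mem_insert_of_mem (h₁.mem _ (key x hx))
  · intro x hx
    have hy := key x hx
    by_cases hxF : x.erase i ∈ F
    · have e1 : crossMatching i D₁ D₂ F x = i := if_pos hxF
      have e2 : (x ∆ {i}).erase i = x.erase i := by
        ext j; simp only [mem_erase, mem_symmDiff, mem_singleton]; tauto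
      rw [e1, crossMatching, e2, if_pos hxF]
    · have step : ∀ t, t ≠ i → (x ∆ {t}).erase i = (x.erase i) ∆ {t} ∧ (i ∈ x ∆ {t} ↔ i ∈ x) := by
        intro t ht
        refine ⟨?_, ?_⟩
        · ext j
          simp only [mem_erase, mem_symmDiff, mem_singleton]
          constructor
          · rintro ⟨h, h' | h'⟩ <;> tauto
          · rintro (⟨⟨h, h'⟩, h''⟩ | ⟨rfl, h''⟩) <;> tauto
        · simp only [mem_symmDiff, mem_singleton]
          have := ht.symm
          tauto
      have back : ∀ D : Finset ι → ι, (D = D₁ ∨ D = D₂) →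
          (x.erase i) ∆ {D (x.erase i)} ∉ F := by
        intro D hD hmem
        have hsymm : D (x.erase i ∆ {D (x.erase i)}) = D (x.erase i) := by
          rcases hD with rfl | rfl
          · exact h₁.symm _ hy
          · exact h₂.symm _ hy
        have e : D₁ (x.erase i ∆ {D (x.erase i)}) = D (x.erase i) := by
          rcases hD with rfl | rfl
          · exact hsymm
          · exact (hF _ hmem).1.trans hsymm
        have := (hF _ hmem).2
        rw [e, symmDiff_symmDiff_cancel_right] at this
        exact hxF this
      by_cases hix : i ∈ x
      · have e1 : crossMatching i D₁ D₂ F x = D₂ (x.erase i) := by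
          rw [crossMatching, if_neg hxF, if_pos hix]
        have hne : D₂ (x.erase i) ≠ i := fun h => hi (h ▸ h₂.mem _ hy)
        rw [e1, crossMatching, (step _ hne).1, if_neg (back D₂ (Or.inr rfl)),
          if_pos ((step _ hne).2.2 hix), h₂.symm _ hy]
      · have e1 : crossMatching i D₁ D₂ F x = D₁ (x.erase i) := by
          rw [crossMatching, if_neg hxF, if_neg hix]
        have hne : D₁ (x.erase i) ≠ i := fun h => hi (h ▸ h₁.mem _ hy)
        rw [e1, crossMatching, (step _ hne).1, if_neg (back D₁ (Or.inl rfl)),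
          if_neg (fun h => hix ((step _ hne).2.1 h)), h₁.symm _ hy]

theorem directionCount_cross_of_ne {S : Finset ι} {i j : ι} {D₁ D₂ : Finset ι → ι}
    (hi : i ∉ S) (hj : j ≠ i) {F : Finset (Finset ι)} (hFS : F ⊆ S.powerset)
    (hF : ∀ x ∈ F, D₁ x = D₂ x) :
    directionCount (insert i S) (crossMatching i D₁ D₂ F) j + 2 * #{x ∈ F | D₁ x = j} =
      directionCount S D₁ j + directionCount S D₂ j := by
  have hFsum : #{x ∈ F | D₁ x = j} = ∑ x ∈ S.powerset, if x ∈ F ∧ D₁ x = j then 1 else 0 := by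
    rw [← card_filter]
    congr 1
    ext x
    simp only [mem_filter]
    constructor
    · rintro ⟨h, h'⟩; exact ⟨hFS h, h, h'⟩
    · rintro ⟨_, h⟩; exact h
  rw [directionCount_eq_sum, sum_powerset_insert hi, hFsum, directionCount_eq_sum,
    directionCount_eq_sum, two_mul, ← sum_add_distrib, ← sum_add_distrib, ← sum_add_distrib,
    ← sum_add_distrib]
  refine sum_congr rfl fun x hx => ?_
  have hix : i ∉ x := fun h => hi (mem_powerset.1 hx h)
  have e1 : x.erase i = x := erase_eq_of_notMem hix
  have e2 : (insert i x).erase i = x := erase_insert hix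
  simp only [crossMatching, e1, e2, hix, mem_insert_self, if_true, if_false]
  by_cases hxF : x ∈ F
  · have := hF x hxF
    simp only [hxF, if_true, true_and, hj.symm, if_false, this]
    omega
  · simp [hxF]

theorem directionCount_cross_self {S : Finset ι} {i : ι} {D₁ D₂ : Finset ι → ι}
    (h₁ : IsCubeMatching S D₁) (h₂ : IsCubeMatching S D₂) (hi : i ∉ S) {F : Finset (Finset ι)}
    (hFS : F ⊆ S.powerset) :
    directionCount (insert i S) (crossMatching i D₁ D₂ F) i = 2 * #F := by
  have hFsum : #F = ∑ x ∈ S.powerset, if x ∈ F then 1 else 0 := by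
    rw [← card_filter, filter_mem_eq_inter, inter_eq_right.2 hFS]
  rw [directionCount_eq_sum, sum_powerset_insert hi, hFsum, two_mul, ← sum_add_distrib,
    ← sum_add_distrib]
  refine sum_congr rfl fun x hx => ?_
  have hxS := mem_powerset.1 hx
  have hix : i ∉ x := fun h => hi (hxS h)
  have e1 : x.erase i = x := erase_eq_of_notMem hix
  have e2 : (insert i x).erase i = x := erase_insert hix
  have n1 : D₁ x ≠ i := fun h => hi (h ▸ h₁.mem x hxS)
  have n2 : D₂ x ≠ i := fun h => hi (h ▸ h₂.mem x hxS)
  simp only [crossMatching, e1, e2, hix, mem_insert_self, if_true, if_false]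
  by_cases hxF : x ∈ F <;> simp [hxF, n1, n2]

/-- Matchings of two opposite facets combine to a matching of the cube. -/
theorem Realizes.glue {S : Finset ι} {i : ι} {D₁ D₂ : Finset ι → ι} {a b : ι → ℕ}
    (h₁ : Realizes S D₁ a) (h₂ : Realizes S D₂ b) (hi : i ∉ S) :
    Realizes (insert i S) (crossMatching i D₁ D₂ ∅) (fun j => a j + b j) := by
  refine ⟨h₁.1.cross h₂.1 hi (by simp), fun j => ?_⟩
  by_cases hj : j = i
  · subst hj
    have e1 := directionCount_eq_zero h₁.1 hi
    have e2 := directionCount_eq_zero h₂.1 hi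
    have e3 := directionCount_cross_self h₁.1 h₂.1 hi (F := ∅) (by simp)
    rw [h₁.2] at e1
    rw [h₂.2] at e2
    rw [e3]
    simp only [card_empty]
    omega
  · have := directionCount_cross_of_ne (D₁ := D₁) (D₂ := D₂) hi hj (F := ∅) (by simp) (by simp)
    rw [h₁.2, h₂.2] at this
    simp only [filter_empty, card_empty] at this ⊢
    omega

/-- Matchings of a cube can be translated. -/
theorem Realizes.translate {S : Finset ι} {D : Finset ι → ι} {a : ι → ℕ} (h : Realizes S D a)
    {t : Finset ι} (ht : t ⊆ S) : Realizes S (fun x => D (x ∆ t)) a := by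
  have hsub : ∀ x ⊆ S, x ∆ t ⊆ S := fun x hx j hj => by
    rcases mem_symmDiff.1 hj with h | h
    · exact hx h.1
    · exact ht h.1
  refine ⟨⟨fun x hx => h.1.mem _ (hsub x hx), fun x hx => ?_⟩, fun i => ?_⟩
  · have := h.1.symm _ (hsub x hx)
    rwa [symmDiff_right_comm] at this
  · rw [← h.2 i, directionCount, directionCount]
    refine card_bij' (fun x _ => x ∆ t) (fun x _ => x ∆ t) ?_ ?_ ?_ ?_
    · intro x hx
      simp only [mem_filter, mem_powerset] at hx ⊢
      exact ⟨hsub x hx.1, hx.2⟩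
    · intro x hx
      simp only [mem_filter, mem_powerset] at hx ⊢
      refine ⟨hsub x hx.1, ?_⟩
      rw [symmDiff_symmDiff_cancel_right]
      exact hx.2
    · intro x _
      exact symmDiff_symmDiff_cancel_right _ _
    · intro x _
      exact symmDiff_symmDiff_cancel_right _ _

/-- A direction that is used at all may be prescribed at the vertex `∅`. -/
theorem Realizes.exists_apply_empty {S : Finset ι} {D : Finset ι → ι} {a : ι → ℕ}
    (h : Realizes S D a) {j : ι} (hj : 0 < a j) : ∃ D', Realizes S D' a ∧ D' ∅ = j := by
  have hpos : 0 < directionCount S D j := by rw [h.2]; omega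
  obtain ⟨x, hx⟩ := card_pos.1 hpos
  simp only [mem_filter, mem_powerset] at hx
  refine ⟨_, h.translate hx.1, ?_⟩
  rw [show (∅ : Finset ι) ∆ x = x from bot_symmDiff x]
  exact hx.2

end CubeMatching

/-! ### Perfect matchings of a cube with prescribed direction counts -/

section Existence

/-- If a multiset of `2 ^ (n + 1)` directions of a cube of dimension `n + 3` uses every direction at
least twice, then the multiplicity of the most frequent one exceeds the number of other directions
of odd multiplicity by a nonnegative even number. -/
theorem card_odd_le_max {ι : Type*} {T : Finset ι} {i : ι} {a : ι → ℕ} {n : ℕ} (hT : #T = n + 2)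
    (hsum : a i + ∑ j ∈ T, a j = 2 * 2 ^ n) (h2i : 2 ≤ a i) (h2 : ∀ j ∈ T, 2 ≤ a j)
    (hmax : ∀ j ∈ T, a j ≤ a i) :
    ∃ r, a i = ∑ j ∈ T, a j % 2 + 2 * r := by
  have hmod : (∑ j ∈ T, a j) % 2 = (∑ j ∈ T, a j % 2) % 2 := sum_nat_mod _ _ _
  have hO : ∑ j ∈ T, a j % 2 ≤ n + 2 := by
    rw [← hT, card_eq_sum_ones]
    exact sum_le_sum fun j _ => by omega
  have hup : ∑ j ∈ T, a j ≤ (n + 2) * a i := by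
    rw [← hT, ← smul_eq_mul]
    exact sum_le_card_nsmul _ _ _ hmax
  have hlow : (n + 2) * 2 ≤ ∑ j ∈ T, a j := by
    rw [← hT, ← smul_eq_mul]
    exact card_nsmul_le_sum _ _ _ h2
  by_contra hcon
  have hlt : a i + 2 ≤ ∑ j ∈ T, a j % 2 := by
    by_contra hlt
    exact hcon ⟨(a i - ∑ j ∈ T, a j % 2) / 2, by omega⟩
  have hai : a i ≤ n := by omega
  have hquad : 2 * 2 ^ n ≤ (n + 3) * n := by nlinarith
  have hn : n ≤ 3 := by
    by_contra hn
    have : ∀ m : ℕ, (m + 4 + 3) * (m + 4) < 2 * 2 ^ (m + 4) := by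
      intro m
      induction m with
      | zero => norm_num
      | succ m ih => rw [show m + 1 + 4 = (m + 4) + 1 by ring, pow_succ]; nlinarith
    have := this (n - 4)
    rw [show n - 4 + 4 = n by omega] at this
    omega
  interval_cases n
  · omega
  · omega
  · omega
  -- In dimension 6 all directions would have multiplicity 3 (or all 2), but neither `6 * 3` nor
  -- `6 * 2` is `16`.
  · have h6 : ∑ j ∈ T, (2 + a j % 2) ≤ ∑ j ∈ T, a j := sum_le_sum fun j hj => by
      have := h2 j hj; omega
    rw [sum_add_distrib, sum_const, hT, smul_eq_mul] at h6
    omega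

variable {ι : Type*} [DecidableEq ι]

theorem exists_le_sum_eq (S : Finset ι) (a : ι → ℕ) (G : ℕ) (hG : G ≤ ∑ i ∈ S, a i) :
    ∃ b : ι → ℕ, (∀ i, b i ≤ a i) ∧ ∑ i ∈ S, b i = G := by
  induction G with
  | zero => exact ⟨0, by simp, by simp⟩
  | succ G ih =>
    obtain ⟨b, hb, hbG⟩ := ih (by omega)
    obtain ⟨i, hiS, hi⟩ : ∃ i ∈ S, b i < a i := exists_lt_of_sum_lt (by omega)
    refine ⟨fun j => b j + if j = i then 1 else 0, fun j => ?_, ?_⟩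
    · dsimp only
      split_ifs with h
      · subst h; omega
      · exact hb j
    · rw [sum_add_distrib, sum_ite_eq' S i, if_pos hiS, hbG]

theorem realizes_const {S : Finset ι} {i : ι} (hi : i ∈ S) {a : ι → ℕ} (ha : 4 * a i = 2 ^ #S)
    (h0 : ∀ j, j ≠ i → a j = 0) : Realizes S (fun _ => i) a := by
  refine ⟨⟨fun _ _ => hi, fun _ _ => rfl⟩, fun j => ?_⟩
  rw [directionCount]
  by_cases hj : j = i
  · subst hj
    simp [ha]
  · rw [h0 j hj, filter_false_of_mem fun _ _ h => hj h.symm]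
    simp

/-- A matching contains a set of edges with any smaller number of edges in each direction. -/
theorem IsCubeMatching.exists_closed_subset {S : Finset ι} {D : Finset ι → ι}
    (hD : IsCubeMatching S D) (β : ι → ℕ) (hβ : ∀ i, 4 * β i ≤ 2 * directionCount S D i) :
    ∃ F ⊆ S.powerset, (∀ x ∈ F, x ∆ {D x} ∈ F) ∧ ∀ i ∈ S, #{x ∈ F | D x = i} = 2 * β i := by
  have hA : ∀ i, ∃ A ⊆ {x ∈ S.powerset | D x = i ∧ i ∉ x}, #A = β i := fun i =>
    exists_subset_card_eq (by have := two_mul_card_filter_notMem hD i; have := hβ i; omega)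
  choose A hAsub hAcard using hA
  have hAmem : ∀ i, ∀ x ∈ A i, x ⊆ S ∧ D x = i ∧ i ∉ x := fun i x hx => by
    have := hAsub i hx
    simpa only [mem_filter, mem_powerset] using this
  have hBmem : ∀ i, ∀ x ∈ (A i).image (· ∆ {i}), x ⊆ S ∧ D x = i ∧ i ∈ x := fun i x hx => by
    obtain ⟨y, hy, rfl⟩ := mem_image.1 hx
    obtain ⟨hyS, rfl, hyi⟩ := hAmem i y hy
    refine ⟨symmDiff_singleton_subset hyS (hD.mem y hyS), hD.symm y hyS, ?_⟩
    simp [mem_symmDiff, hyi]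
  have hUmem : ∀ i, ∀ x ∈ A i ∪ (A i).image (· ∆ {i}), x ⊆ S ∧ D x = i := fun i x hx => by
    rcases mem_union.1 hx with h | h
    · exact ⟨(hAmem i x h).1, (hAmem i x h).2.1⟩
    · exact ⟨(hBmem i x h).1, (hBmem i x h).2.1⟩
  refine ⟨S.biUnion fun i => A i ∪ (A i).image (· ∆ {i}), ?_, ?_, ?_⟩
  · intro x hx
    obtain ⟨i, _, hx⟩ := mem_biUnion.1 hx
    exact mem_powerset.2 (hUmem i x hx).1
  · intro x hx
    obtain ⟨i, hi, hx⟩ := mem_biUnion.1 hx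
    refine mem_biUnion.2 ⟨i, hi, ?_⟩
    rw [(hUmem i x hx).2]
    rcases mem_union.1 hx with h | h
    · exact mem_union_right _ (mem_image_of_mem _ h)
    · obtain ⟨y, hy, rfl⟩ := mem_image.1 h
      refine mem_union_left _ ?_
      rwa [symmDiff_symmDiff_cancel_right]
  · intro i hi
    have e : {x ∈ S.biUnion fun i => A i ∪ (A i).image (· ∆ {i}) | D x = i} =
        A i ∪ (A i).image (· ∆ {i}) := by
      ext x
      simp only [mem_filter, mem_biUnion]
      constructor
      · rintro ⟨⟨j, _, hx⟩, hj⟩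
        rwa [← hj, (hUmem j x hx).2]
      · intro hx
        exact ⟨⟨i, hi, hx⟩, (hUmem i x hx).2⟩
    rw [e, card_union_of_disjoint, card_image_of_injective (A i) (symmDiff_left_injective {i}),
      hAcard,
      two_mul]
    rw [disjoint_left]
    intro x hx hx'
    exact (hAmem i x hx).2.2 (hBmem i x hx').2.2

/-- Two parallel copies of a matching, with `β j` pairs of parallel edges in direction `j` rerouted
through the new direction `i`. -/
theorem Realizes.double {T : Finset ι} {D : Finset ι → ι} {α : ι → ℕ} (h : Realizes T D α) {i : ι}
    (hi : i ∉ T) (β : ι → ℕ) (hβ : ∀ j, β j ≤ 2 * α j) {a : ι → ℕ} (hai : a i = ∑ j ∈ T, β j)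
    (haj : ∀ j, j ≠ i → a j + β j = 2 * α j) : ∃ D', Realizes (insert i T) D' a := by
  obtain ⟨F, hFT, hF, hFcard⟩ := h.1.exists_closed_subset β (fun j => by
    have := hβ j; rw [h.2]; omega)
  refine ⟨crossMatching i D D F, h.1.cross h.1 hi fun x hx => ⟨rfl, hF x hx⟩, fun j => ?_⟩
  by_cases hj : j = i
  · subst hj
    rw [directionCount_cross_self h.1 h.1 hi hFT, hai,
      card_eq_sum_card_fiberwise fun x hx => h.1.mem x (mem_powerset.1 (hFT hx)),
      sum_congr rfl hFcard, ← mul_sum]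
    omega
  · have h1 := directionCount_cross_of_ne (D₁ := D) (D₂ := D) hi hj hFT fun _ _ => rfl
    have h2 := haj j hj
    rw [h.2] at h1
    by_cases hjT : j ∈ T
    · rw [hFcard j hjT] at h1
      omega
    · have h3 := directionCount_eq_zero h.1 hjT
      rw [h.2] at h3
      omega

/-- In a cube of dimension at least two, every vector of even direction counts with the right total
is attained by a perfect matching. -/
theorem exists_realizes (S : Finset ι) (hS : 2 ≤ #S) (a : ι → ℕ) (ha : 4 * ∑ i ∈ S, a i = 2 ^ #S)
    (h0 : ∀ i, i ∉ S → a i = 0) : ∃ D, Realizes S D a := by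
  obtain ⟨n, hn⟩ : ∃ n, #S = n + 2 := ⟨#S - 2, by omega⟩
  induction n generalizing S a with
  | zero =>
    have hsum : ∑ i ∈ S, a i = 1 := by rw [hn] at ha; omega
    obtain ⟨i, hi, hai⟩ : ∃ i ∈ S, 0 < a i := by
      by_contra! hcon
      have : ∑ i ∈ S, a i = 0 := sum_eq_zero fun i hi => by have := hcon i hi; omega
      omega
    rw [← add_sum_erase S a hi] at hsum
    have hz : ∑ j ∈ S.erase i, a j = 0 := by omega
    rw [sum_eq_zero_iff] at hz
    refine ⟨fun _ => i, realizes_const hi (by rw [hn]; omega) fun j hj => ?_⟩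
    by_cases hjS : j ∈ S
    · exact hz j (mem_erase.2 ⟨hj, hjS⟩)
    · exact h0 j hjS
  | succ n ih =>
    have hpow : 2 ^ #S = 8 * 2 ^ n := by rw [hn]; ring
    have hpow' : 2 ^ (n + 2) = 4 * 2 ^ n := by ring
    have hpos : 0 < 2 ^ n := by positivity
    have hsum : ∑ i ∈ S, a i = 2 * 2 ^ n := by omega
    by_cases hz : ∃ i ∈ S, a i = 0
    · obtain ⟨i, hi, hai⟩ := hz
      have hc : #(S.erase i) = n + 2 := by rw [card_erase_of_mem hi]; omega
      have hs := add_sum_erase S a hi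
      obtain ⟨b, hba, hb⟩ := exists_le_sum_eq (S.erase i) a (2 ^ n) (by omega)
      have h0' : ∀ j, j ∉ S.erase i → a j = 0 := fun j hj => by
        by_cases hji : j = i
        · rw [hji, hai]
        · exact h0 j fun h => hj (mem_erase.2 ⟨hji, h⟩)
      have hsub : ∑ j ∈ S.erase i, (a j - b j) + ∑ j ∈ S.erase i, b j = ∑ j ∈ S.erase i, a j := by
        rw [← sum_add_distrib]
        exact sum_congr rfl fun j _ => Nat.sub_add_cancel (hba j)
      obtain ⟨D₁, h₁⟩ := ih (S.erase i) (by omega) b (by rw [hc, hb, hpow'])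
        (fun j hj => by have := h0' j hj; have := hba j; omega) hc
      obtain ⟨D₂, h₂⟩ := ih (S.erase i) (by omega) (fun j => a j - b j)
        (by rw [hc, hpow']; omega) (fun j hj => by have := h0' j hj; omega) hc
      have := h₁.glue h₂ (notMem_erase i S)
      rw [insert_erase hi] at this
      have hab : (fun j => b j + (a j - b j)) = a := funext fun j => Nat.add_sub_cancel' (hba j)
      rw [hab] at this
      exact ⟨_, this⟩
    push Not at hz
    by_cases ho : ∃ i ∈ S, a i = 1
    · obtain ⟨i, hi, hai⟩ := ho
      have hc : #(S.erase i) = n + 2 := by rw [card_erase_of_mem hi]; omega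
      obtain ⟨j, hj⟩ : (S.erase i).Nonempty := card_pos.1 (by omega)
      have hji : j ≠ i := ne_of_mem_erase hj
      have haj := hz j (mem_of_mem_erase hj)
      have hs := add_sum_erase S a hi
      have hs' := add_sum_erase (S.erase i) a hj
      -- Both facets get at least one pair of edges in direction `j`; translated so that these
      -- meet, they give one parallel pair to reroute through direction `i`.
      let δ : ι → ℕ := fun l => if l = j then 1 else 0
      let c : ι → ℕ := fun l => if l = i then 0 else a l - δ l
      have hδ : ∑ l ∈ S.erase i, δ l = 1 := by
        simp only [δ, sum_ite_eq', hj, if_true]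
      have hcsum : ∑ l ∈ S.erase i, c l + 1 = ∑ l ∈ S.erase i, a l := by
        rw [← hδ, ← sum_add_distrib]
        refine sum_congr rfl fun l hl => ?_
        simp only [c, δ, ne_of_mem_erase hl, if_false]
        split_ifs with h
        · subst h; omega
        · rfl
      have hc0 : ∀ l, l ∉ S.erase i → c l = 0 := fun l hl => by
        by_cases hli : l = i
        · simp [c, hli]
        · have := h0 l fun h => hl (mem_erase.2 ⟨hli, h⟩)
          simp [c, hli, this]
      have hδ0 : ∀ l, l ∉ S.erase i → δ l = 0 := fun l hl =>
        if_neg (by rintro rfl; exact hl hj)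
      obtain ⟨b, hbc, hb⟩ := exists_le_sum_eq (S.erase i) c (2 ^ n - 1) (by omega)
      have hsub : ∑ j ∈ S.erase i, (c j - b j) + ∑ j ∈ S.erase i, b j = ∑ j ∈ S.erase i, c j := by
        rw [← sum_add_distrib]
        exact sum_congr rfl fun j _ => Nat.sub_add_cancel (hbc j)
      obtain ⟨D₁, h₁⟩ := ih (S.erase i) (by omega) (fun l => b l + δ l)
        (by rw [hc, hpow', sum_add_distrib, hδ]; omega)
        (fun l hl => by have := hc0 l hl; have := hδ0 l hl; have := hbc l; omega) hc
      obtain ⟨D₂, h₂⟩ := ih (S.erase i) (by omega) (fun l => c l - b l + δ l)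
        (by rw [hc, hpow', sum_add_distrib, hδ]; omega)
        (fun l hl => by have := hc0 l hl; have := hδ0 l hl; omega) hc
      obtain ⟨D₁, h₁, e₁⟩ := h₁.exists_apply_empty (j := j) (by simp [δ])
      obtain ⟨D₂, h₂, e₂⟩ := h₂.exists_apply_empty (j := j) (by simp [δ])
      have hempty : (∅ : Finset ι) ∆ {j} = {j} := bot_symmDiff _
      have f₁ : D₁ {j} = j := by
        have := h₁.1.symm ∅ (empty_subset _)
        rwa [e₁, hempty] at this
      have f₂ : D₂ {j} = j := by
        have := h₂.1.symm ∅ (empty_subset _)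
        rwa [e₂, hempty] at this
      have hFsub : ({∅, {j}} : Finset (Finset ι)) ⊆ (S.erase i).powerset := by
        intro x hx
        rw [mem_insert, mem_singleton] at hx
        rcases hx with rfl | rfl
        · exact empty_mem_powerset _
        · exact mem_powerset.2 (singleton_subset_iff.2 hj)
      have hFcard : #({∅, {j}} : Finset (Finset ι)) = 2 :=
        card_pair (singleton_ne_empty j).symm
      have hF : ∀ x ∈ ({∅, {j}} : Finset (Finset ι)), D₁ x = j ∧ D₂ x = j := by
        intro x hx
        rw [mem_insert, mem_singleton] at hx
        rcases hx with rfl | rfl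
        · exact ⟨e₁, e₂⟩
        · exact ⟨f₁, f₂⟩
      have hins := insert_erase hi
      refine ⟨crossMatching i D₁ D₂ {∅, {j}}, ?_, fun l => ?_⟩
      · rw [← hins]
        refine h₁.1.cross h₂.1 (notMem_erase i S) fun x hx => ⟨?_, ?_⟩
        · rw [(hF x hx).1, (hF x hx).2]
        · rw [(hF x hx).1]
          rw [mem_insert, mem_singleton] at hx
          rcases hx with rfl | rfl
          · rw [hempty]; exact mem_insert_of_mem (mem_singleton_self _)
          · rw [symmDiff_self]; exact mem_insert_self _ _
      · rw [← hins]
        by_cases hl : l = i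
        · subst hl
          rw [directionCount_cross_self h₁.1 h₂.1 (notMem_erase _ S) hFsub, hFcard, hai]
        · have h3 := directionCount_cross_of_ne (D₁ := D₁) (D₂ := D₂) (notMem_erase i S) hl hFsub
            fun x hx => by rw [(hF x hx).1, (hF x hx).2]
          rw [h₁.2, h₂.2] at h3
          dsimp only at h3
          have hbl := hbc l
          have hcl : c l = a l - δ l := if_neg hl
          by_cases hlj : l = j
          · subst hlj
            rw [filter_true_of_mem fun x hx => (hF x hx).1, hFcard] at h3
            have : δ l = 1 := if_pos rfl
            omega
          · rw [filter_false_of_mem fun x hx h => hlj (h.symm.trans (hF x hx).1), card_empty] at h3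
            have : δ l = 0 := if_neg hlj
            omega
    · push Not at ho
      have h2 : ∀ j ∈ S, 2 ≤ a j := fun j hj => by
        have := hz j hj; have := ho j hj; omega
      obtain ⟨i, hi, hmax⟩ := exists_max_image S a (card_pos.1 (by omega))
      have hc : #(S.erase i) = n + 2 := by rw [card_erase_of_mem hi]; omega
      have hs := add_sum_erase S a hi
      obtain ⟨r, hr⟩ := card_odd_le_max (a := a) hc (by omega) (h2 i hi)
        (fun j hj => h2 j (mem_of_mem_erase hj)) (fun j hj => hmax j (mem_of_mem_erase hj))
      obtain ⟨j, hj⟩ : (S.erase i).Nonempty := card_pos.1 (by omega)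
      -- The rerouted pairs first make all counts even; the surplus is taken in one direction `j`.
      let β : ι → ℕ := fun l => if l = i then 0 else a l % 2 + if l = j then 2 * r else 0
      have hβsum : ∑ l ∈ S.erase i, β l = a i := by
        have : ∑ l ∈ S.erase i, β l =
            ∑ l ∈ S.erase i, (a l % 2 + if l = j then 2 * r else 0) :=
          sum_congr rfl fun l hl => if_neg (ne_of_mem_erase hl)
        rw [this, sum_add_distrib, sum_ite_eq', if_pos hj, hr]
      let α : ι → ℕ := fun l => if l = i then 0 else (a l + β l) / 2
      have hα : ∀ l, l ≠ i → a l + β l = 2 * α l := fun l hl => by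
        simp only [α, β, hl, if_false]
        split_ifs <;> omega
      have hαsum : 2 * ∑ l ∈ S.erase i, α l = 2 * 2 ^ n := by
        rw [mul_sum, ← sum_congr rfl fun l hl => hα l (ne_of_mem_erase hl), sum_add_distrib, hβsum]
        omega
      obtain ⟨D, hD⟩ := ih (S.erase i) (by omega) α (by rw [hc, hpow']; omega) (fun l hl => by
        by_cases hli : l = i
        · simp [α, hli]
        · have h1 := h0 l fun h => hl (mem_erase.2 ⟨hli, h⟩)
          have h2 : l ≠ j := fun h => hl (h ▸ hj)
          simp [α, β, hli, h1, h2]) hc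
      have hins := insert_erase hi
      rw [← hins]
      refine hD.double (notMem_erase i S) β (fun l => ?_) hβsum.symm hα
      by_cases hli : l = i
      · simp [β, hli]
      · have := hα l hli
        omega

end Existence

/-! ### Prescribing the matching at the spine -/

section Spine

/-- The greedy way of taking `G` from a sequence: its partial sums are those of the sequence, cut
off at `G`. -/
theorem exists_greedy (h : ℕ → ℕ) (G : ℕ) : ∃ g : ℕ → ℕ, (∀ i, g i ≤ h i) ∧
    (∀ r, ∑ i ∈ range r, g i = min G (∑ i ∈ range r, h i)) ∧
    ∀ i r, r ≤ i → G ≤ ∑ j ∈ range r, h j → g i = 0 := by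
  have hmono : Monotone fun r => ∑ i ∈ range r, h i := fun r s hrs =>
    sum_le_sum_of_subset (range_subset_range.2 hrs)
  refine ⟨fun i => min G (∑ j ∈ range (i + 1), h j) - min G (∑ j ∈ range i, h j), fun i => ?_,
    fun r => ?_, fun i r hri hG => ?_⟩
  · dsimp only
    rw [sum_range_succ]
    omega
  · rw [sum_range_tsub fun r s hrs => min_le_min le_rfl (hmono hrs)]
    simp
  · have h1 := hmono hri
    have h2 := hmono (Nat.le_succ i)
    dsimp only at h1 h2 ⊢
    rw [Nat.succ_eq_add_one] at h2
    omega

theorem two_pow_add_le {r m : ℕ} (h : r ≤ m) : 2 ^ r + m ≤ 2 ^ m + r := by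
  induction m, h using Nat.le_induction with
  | base => exact le_rfl
  | succ m _ ih =>
    have : 0 < 2 ^ m := by positivity
    rw [pow_succ]
    omega

/-- Let `p` be the parent function of a rooted tree on `0, …, m + 1` with root `0`. The cube on
these vertices has a perfect matching in which the partner of `∅` is `{0}` and the partner of each
other singleton `{t}` is `{t, p t}`; its direction counts can be prescribed as long as the
multiplicities `g` left over by these edges have large enough partial sums.

The matching is built along the facets `⟨0, …, t - 1⟩ + t`: each contains only one prescribed edge,
which is put in place by a translation. -/
theorem exists_realizes_of_tree (m : ℕ) (p g : ℕ → ℕ) (hp : ∀ t, 1 ≤ t → t < m + 2 → p t < t)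
    (hpre : ∀ r ≤ m, 2 ^ r ≤ ∑ i ∈ range (r + 1), g i + (r + 1))
    (hsum : ∑ i ∈ range (m + 1), g i + (m + 1) = 2 ^ m) (h0 : ∀ i, m + 1 ≤ i → g i = 0) :
    ∃ D, Realizes (range (m + 2)) D (fun i => g i + #{t ∈ Ico 1 (m + 2) | p t = i}) ∧
      D ∅ = 0 ∧ ∀ t, 1 ≤ t → t < m + 2 → D {t} = p t := by
  induction m generalizing g with
  | zero =>
    have hp1 : p 1 = 0 := by have := hp 1 le_rfl (by omega); omega
    have hg : ∀ i, g i = 0 := fun i => by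
      rcases Nat.eq_zero_or_pos i with rfl | hi
      · simpa using hsum
      · exact h0 i (by omega)
    have hI : Ico 1 (0 + 2) = {1} := by decide
    refine ⟨fun _ => 0, realizes_const (by simp) ?_ ?_, rfl, fun t h1 h2 => ?_⟩
    · rw [hg, hI, filter_singleton, if_pos hp1]
      simp
    · intro j hj
      rw [hg, hI, filter_singleton, if_neg (by rw [hp1]; exact hj.symm)]
      simp
    · obtain rfl : t = 1 := by omega
      exact hp1.symm
  | succ m ih =>
    have hm : m + 1 ≤ 2 ^ m := Nat.lt_two_pow_self
    have hpow : 2 ^ (m + 1) = 2 * 2 ^ m := by ring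
    have hpow' : 2 ^ (m + 2) = 4 * 2 ^ m := by ring
    obtain ⟨g', hg'le, hg'sum, hg'0⟩ := exists_greedy g (2 ^ m - (m + 1))
    have hlow := hpre m (by omega)
    have hsum' : ∑ i ∈ range (m + 2), g i + (m + 2) = 2 ^ (m + 1) := hsum
    have hg'0' : ∀ i, m + 1 ≤ i → g' i = 0 := fun i hi => hg'0 i (m + 1) hi (by omega)
    obtain ⟨D₁, h₁, h₁root, h₁sing⟩ := ih g' (fun t h1 h2 => hp t h1 (by omega))
      (fun r hr => by
        have h1 := hpre r (by omega)
        have h2 := two_pow_add_le hr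
        rw [hg'sum]
        omega)
      (by rw [hg'sum]; omega) hg'0'
    have hpm := hp (m + 2) (by omega) (by omega)
    let δ : ℕ → ℕ := fun i => if i = p (m + 2) then 1 else 0
    have hδ : ∑ i ∈ range (m + 2), δ i = 1 := by
      simp only [δ, sum_ite_eq', mem_range, hpm, if_true]
    have hsub : ∑ j ∈ range (m + 2), (g j - g' j) + ∑ j ∈ range (m + 2), g' j =
        ∑ j ∈ range (m + 2), g j := by
      rw [← sum_add_distrib]
      exact sum_congr rfl fun j _ => Nat.sub_add_cancel (hg'le j)
    have hg'tot : ∑ j ∈ range (m + 2), g' j = 2 ^ m - (m + 1) := by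
      rw [sum_range_succ, hg'sum, hg'0' (m + 1) le_rfl]
      omega
    obtain ⟨D₂, h₂⟩ := exists_realizes (range (m + 2)) (by simp) (fun i => g i - g' i + δ i)
      (by rw [sum_add_distrib, hδ, card_range, hpow']; omega) (fun i hi => by
        rw [mem_range] at hi
        have h1 := h0 i (by omega)
        have h2 : δ i = 0 := if_neg (by omega)
        omega)
    obtain ⟨D₂, h₂, h₂e⟩ := h₂.exists_apply_empty (j := p (m + 2)) (by simp [δ])
    have hglue := h₁.glue h₂ (i := m + 2) (by simp)
    have hins : insert (m + 2) (range (m + 2)) = range (m + 1 + 2) := by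
      rw [← range_add_one]
    rw [hins] at hglue
    refine ⟨crossMatching (m + 2) D₁ D₂ ∅, ?_, by simpa [crossMatching] using h₁root,
      fun t h1 h2 => ?_⟩
    rotate_left
    · by_cases ht : t = m + 2
      · subst ht
        simpa [crossMatching] using h₂e
      · have e : ({t} : Finset ℕ).erase (m + 2) = {t} :=
          erase_eq_of_notMem (by rw [mem_singleton]; omega)
        have e' : m + 2 ∉ ({t} : Finset ℕ) := by rw [mem_singleton]; omega
        simp only [crossMatching, e, e', notMem_empty, if_false]
        exact h₁sing t h1 (by omega)
    · have : (fun i => g i + #{t ∈ Ico 1 (m + 1 + 2) | p t = i}) =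
          fun i => g' i + #{t ∈ Ico 1 (m + 2) | p t = i} + (g i - g' i + δ i) := by
        funext i
        have hI : Ico 1 (m + 1 + 2) = insert (m + 2) (Ico 1 (m + 2)) := by
          ext; simp only [mem_Ico, mem_insert]; omega
        have hle := hg'le i
        rw [hI, filter_insert]
        by_cases hi : p (m + 2) = i
        · rw [if_pos hi, card_insert_of_notMem (by simp)]
          have : δ i = 1 := if_pos hi.symm
          omega
        · rw [if_neg hi]
          have : δ i = 0 := if_neg (Ne.symm hi)
          omega
      rw [this]
      exact hglue

/-- A perfect matching extends to cubes of higher dimension, using the old directions only. -/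
theorem Realizes.exists_extend {d : ℕ} (hd : 2 ≤ d) {D : Finset ℕ → ℕ} {a : ℕ → ℕ}
    (h : Realizes (range d) D a) (m : ℕ) (e : ℕ → ℕ) (h0 : ∀ i, d ≤ i → e i = 0)
    (hsum : 4 * ∑ i ∈ range d, e i + 2 ^ d = 2 ^ (d + m)) :
    ∃ D', Realizes (range (d + m)) D' (fun i => a i + e i) ∧ ∀ x ⊆ range d, D' x = D x := by
  induction m generalizing e with
  | zero =>
    have hz : ∑ i ∈ range d, e i = 0 := by rw [add_zero] at hsum; omega
    rw [sum_eq_zero_iff] at hz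
    have he : (fun i => a i + e i) = a := by
      funext i
      by_cases hi : i < d
      · rw [hz i (mem_range.2 hi), add_zero]
      · rw [h0 i (by omega), add_zero]
    exact ⟨D, by rwa [he], fun _ _ => rfl⟩
  | succ m ih =>
    obtain ⟨d, rfl⟩ : ∃ d', d = d' + 2 := ⟨d - 2, by omega⟩
    have hp1 : 2 ^ (d + 2) = 4 * 2 ^ d := by ring
    have hp2 : 2 ^ (d + 2 + m) = 4 * 2 ^ (d + m) := by ring
    have hp3 : 2 ^ (d + 2 + (m + 1)) = 8 * 2 ^ (d + m) := by ring
    have hle : 2 ^ d ≤ 2 ^ (d + m) := Nat.pow_le_pow_right (by omega) (by omega)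
    obtain ⟨e', he'le, he'⟩ := exists_le_sum_eq (range (d + 2)) e (2 ^ (d + m) - 2 ^ d) (by omega)
    obtain ⟨D₁, h₁, hD₁⟩ := ih e' (fun i hi => by have := h0 i hi; have := he'le i; omega)
      (by omega)
    have hsub : ∑ j ∈ range (d + 2), (e j - e' j) + ∑ j ∈ range (d + 2), e' j =
        ∑ j ∈ range (d + 2), e j := by
      rw [← sum_add_distrib]
      exact sum_congr rfl fun j _ => Nat.sub_add_cancel (he'le j)
    have hext : ∑ j ∈ range (d + 2), (e j - e' j) = ∑ j ∈ range (d + 2 + m), (e j - e' j) := by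
      refine sum_subset (range_subset_range.2 (by omega)) fun j _ hj => ?_
      rw [mem_range] at hj
      have := h0 j (by omega)
      omega
    obtain ⟨D₂, h₂⟩ := exists_realizes (range (d + 2 + m)) (by rw [card_range]; omega)
      (fun i => e i - e' i) (by rw [card_range, ← hext]; omega) (fun i hi => by
        rw [mem_range] at hi
        have := h0 i (by omega)
        omega)
    have hglue := h₁.glue h₂ (i := d + 2 + m) (by simp)
    have hins : insert (d + 2 + m) (range (d + 2 + m)) = range (d + 2 + (m + 1)) := by
      rw [← range_add_one, add_assoc (d + 2)]
    have hfun : (fun i => a i + e' i + (e i - e' i)) = fun i => a i + e i := by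
      funext i
      have := he'le i
      omega
    rw [hins, hfun] at hglue
    refine ⟨_, hglue, fun x hx => ?_⟩
    have hnot : d + 2 + m ∉ x := fun hmem => by
      have := mem_range.1 (hx hmem)
      omega
    simp only [crossMatching, notMem_empty, if_false, hnot, erase_eq_of_notMem hnot]
    exact hD₁ x hx

/-- The matching from which the labeling of a caterpillar is read off. The spine is enumerated from
a root `0`, first along one branch and then, from position `c` on, along the other one, so that
`p` is the parent function. As `0` has the largest multiplicity, the partial sums of the
multiplicities `a` grow fast enough. -/
theorem exists_spine_matching {K n c : ℕ} (hK : 1 ≤ K) (hKn : K ≤ n) {a p : ℕ → ℕ}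
    (hp : ∀ t, p t = if t = c then 0 else t - 1) (h0 : ∀ i, K ≤ i → a i = 0)
    (hsum : 4 * ∑ i ∈ range K, a i = 2 ^ (n + 1)) (hmax : ∀ i, a i ≤ a 0)
    (hch : ∀ i, #{t ∈ range K | p t = i} ≤ 2 * a i) :
    ∃ D, Realizes (range (n + 1)) D a ∧ D ∅ = 0 ∧ ∀ t, 1 ≤ t → t < K → D {t} = p t := by
  obtain rfl | ⟨m, rfl⟩ : K = 1 ∨ ∃ m, K = m + 2 := by
    rcases Nat.lt_or_ge K 2 with h | h
    · left; omega
    · right; exact ⟨K - 2, by omega⟩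
  · refine ⟨fun _ => 0, realizes_const (by simp) ?_ fun j hj => h0 j (by omega), rfl, ?_⟩
    · rw [card_range, ← hsum, sum_range_one]
    · intro t h1 h2; omega
  have hp0 : p 0 = 0 := by rw [hp]; split_ifs <;> rfl
  set ch : ℕ → ℕ := fun i => #{t ∈ Ico 1 (m + 2) | p t = i}
  have hcha : ∀ i, ch i ≤ a i := by
    intro i
    have h1 := hch i
    rcases Nat.eq_zero_or_pos i with rfl | hi
    · have h2 : #{t ∈ range (m + 2) | p t = 0} = ch 0 + 1 := by
        have : range (m + 2) = insert 0 (Ico 1 (m + 2)) := by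
          ext; simp only [mem_range, mem_insert, mem_Ico]; omega
        rw [this, filter_insert, if_pos hp0, card_insert_of_notMem (by simp)]
      have h3 : ch 0 ≤ 2 := by
        refine (card_le_card (t := {1, c}) fun t ht => ?_).trans card_le_two
        rw [mem_filter, mem_Ico, hp] at ht
        rw [mem_insert, mem_singleton]
        split_ifs at ht <;> omega
      omega
    · have h2 : ch i ≤ #{t ∈ range (m + 2) | p t = i} :=
        card_le_card (filter_subset_filter _ fun t ht => by
          rw [mem_Ico] at ht; rw [mem_range]; omega)
      have h3 : ch i ≤ 1 := by
        rw [← card_singleton (i + 1)]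
        refine card_le_card fun t ht => ?_
        rw [mem_filter, mem_Ico, hp] at ht
        rw [mem_singleton]
        split_ifs at ht <;> omega
      omega
  have hchsum : ∀ r, ∑ i ∈ range r, ch i = #{t ∈ Ico 1 (m + 2) | p t < r} := by
    intro r
    rw [card_eq_sum_card_fiberwise (f := p) (t := range r) fun t ht => by
      rw [mem_coe, mem_filter] at ht; exact mem_range.2 ht.2]
    refine sum_congr rfl fun i hi => ?_
    rw [filter_filter]
    refine congrArg card (Finset.ext fun t => ?_)
    simp only [mem_filter]
    rw [mem_range] at hi
    constructor
    · rintro ⟨h1, rfl⟩; exact ⟨h1, hi, rfl⟩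
    · rintro ⟨h1, _, h2⟩; exact ⟨h1, h2⟩
  have hchtop : ∀ r, ∑ i ∈ range r, ch i ≤ m + 1 := fun r => by
    rw [hchsum]
    refine (card_filter_le _ _).trans ?_
    rw [Nat.card_Ico]
    omega
  have hchr : ∀ r, ∑ i ∈ range (r + 1), ch i ≤ r + 2 := fun r => by
    rw [hchsum]
    have : {t ∈ Ico 1 (m + 2) | p t < r + 1} ⊆ insert c (Ico 1 (r + 2)) := fun t ht => by
      rw [mem_filter, mem_Ico, hp] at ht
      rw [mem_insert, mem_Ico]
      split_ifs at ht <;> omega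
    refine (card_le_card this).trans ((card_insert_le _ _).trans ?_)
    rw [Nat.card_Ico]
    omega
  have hpown : 2 ^ (n + 1) = 4 * 2 ^ (n - 1) := by
    rw [show n + 1 = n - 1 + 2 by omega, pow_add]; ring
  have hpowle : 2 ^ (m + 1) ≤ 2 ^ (n - 1) := Nat.pow_le_pow_right (by omega) (by omega)
  have hPr : ∀ r ≤ m, 2 ^ (m + 1) ≤ (∑ i ∈ range (r + 1), a i) * (m - r + 2) := by
    intro r hr
    have h1 : ∑ i ∈ range (r + 1), a i + ∑ i ∈ Ico (r + 1) (m + 2), a i =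
        ∑ i ∈ range (m + 2), a i := sum_range_add_sum_Ico _ (by omega)
    have h2 : ∑ i ∈ Ico (r + 1) (m + 2), a i ≤ (m - r + 1) * a 0 := by
      refine (sum_le_card_nsmul _ _ (a 0) fun i _ => hmax i).trans ?_
      rw [Nat.card_Ico, smul_eq_mul, show m + 2 - (r + 1) = m - r + 1 by omega]
    have h3 : a 0 ≤ ∑ i ∈ range (r + 1), a i :=
      single_le_sum (f := a) (fun i _ => Nat.zero_le _) (mem_range.2 (Nat.succ_pos r))
    have h4 : (m - r + 1) * a 0 ≤ (m - r + 1) * ∑ i ∈ range (r + 1), a i :=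
      Nat.mul_le_mul_left _ h3
    have h5 : (∑ i ∈ range (r + 1), a i) * (m - r + 2) =
      ∑ i ∈ range (r + 1), a i + (m - r + 1) * ∑ i ∈ range (r + 1), a i := by ring
    omega
  have hasplit : ∀ r, ∑ i ∈ range r, (a i - ch i) + ∑ i ∈ range r, ch i = ∑ i ∈ range r, a i :=
    fun r => by
      rw [← sum_add_distrib]
      exact sum_congr rfl fun i _ => Nat.sub_add_cancel (hcha i)
  have hpre : ∀ r ≤ m, 2 ^ r ≤ ∑ i ∈ range (r + 1), (a i - ch i) + (r + 1) := by
    intro r hr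
    have h1 := hPr r hr
    have h2 := hasplit (r + 1)
    rcases hr.eq_or_lt with rfl | hlt
    · have h3 := hchtop (r + 1)
      rw [Nat.sub_self, pow_succ] at h1
      omega
    · have h3 := hchr r
      by_contra hcon
      have h4 : ∑ i ∈ range (r + 1), a i ≤ 2 ^ r := by omega
      obtain ⟨j, rfl⟩ : ∃ j, m = r + 1 + j := ⟨m - (r + 1), by omega⟩
      have h5 : 2 ^ (r + 1 + j + 1) ≤ 2 ^ r * (r + 1 + j - r + 2) :=
        h1.trans (Nat.mul_le_mul_right _ h4)
      rw [show r + 1 + j + 1 = r + (j + 2) by ring, pow_add,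
        show r + 1 + j - r + 2 = j + 3 by omega] at h5
      have h6 := Nat.le_of_mul_le_mul_left h5 (by positivity)
      have h7 : j + 1 ≤ 2 ^ j := Nat.lt_two_pow_self
      rw [pow_add] at h6
      omega
  have hm : m + 1 ≤ 2 ^ m := Nat.lt_two_pow_self
  obtain ⟨g, hgle, hgsum, hg0⟩ := exists_greedy (fun i => a i - ch i) (2 ^ m - (m + 1))
  have hlow := hpre m le_rfl
  have hg0' : ∀ i, m + 1 ≤ i → g i = 0 := fun i hi => hg0 i (m + 1) hi (by omega)
  obtain ⟨D, hD, hDroot, hDsing⟩ := exists_realizes_of_tree m p g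
    (fun t h1 h2 => by rw [hp]; split_ifs <;> omega)
    (fun r hr => by
      have h1 := hpre r hr
      have h2 := two_pow_add_le hr
      rw [hgsum]
      omega)
    (by rw [hgsum]; omega) hg0'
  have hchall : ∑ i ∈ range (m + 2), ch i = m + 1 := by
    rw [hchsum, filter_true_of_mem, Nat.card_Ico]
    · omega
    · intro t ht
      rw [mem_Ico] at ht
      rw [hp]
      split_ifs <;> omega
  have hsub : ∑ j ∈ range (m + 2), (a j - ch j - g j) + ∑ j ∈ range (m + 2), g j =
      ∑ j ∈ range (m + 2), (a j - ch j) := by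
    rw [← sum_add_distrib]
    exact sum_congr rfl fun j _ => Nat.sub_add_cancel (hgle j)
  have hgtot : ∑ j ∈ range (m + 2), g j = 2 ^ m - (m + 1) := by
    rw [sum_range_succ, hgsum, hg0' (m + 1) le_rfl]
    omega
  have hall := hasplit (m + 2)
  have hpowm : 2 ^ (m + 2) = 4 * 2 ^ m := by ring
  obtain ⟨D', hD', hext⟩ := hD.exists_extend (by omega) (n - 1 - m) (fun i => a i - ch i - g i)
    (fun i hi => by have := h0 i hi; omega)
    (by rw [show m + 2 + (n - 1 - m) = n + 1 by omega]; omega)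
  have hfun : (fun i => g i + ch i + (a i - ch i - g i)) = a := by
    funext i
    have h1 := hgle i
    have h2 := hcha i
    omega
  rw [show m + 2 + (n - 1 - m) = n + 1 by omega] at hD'
  refine ⟨D', ?_, ?_, fun t h1 h2 => ?_⟩
  · rw [← hfun]
    exact hD'
  · rw [hext ∅ (empty_subset _), hDroot]
  · rw [hext {t} (by simpa using h2), hDsing t h1 h2]

end Spine

/-! ### From a matching to a set-sequential labeling -/

section Labeling

open SimpleGraph

/-- The vector of `𝔽₂ᴺ` with support `x`. -/
def indicatorVector (N : ℕ) (x : Finset ℕ) : Fin N → ZMod 2 :=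
  fun i => if (i : ℕ) ∈ x then 1 else 0

theorem indicatorVector_symmDiff (N : ℕ) (x y : Finset ℕ) :
    indicatorVector N (x ∆ y) = indicatorVector N x + indicatorVector N y := by
  have h2 : (1 : ZMod 2) + 1 = 0 := by decide
  funext i
  simp only [indicatorVector, Pi.add_apply, mem_symmDiff]
  by_cases hx : (i : ℕ) ∈ x <;> by_cases hy : (i : ℕ) ∈ y <;> simp [hx, hy, h2]

theorem exists_indicatorVector_eq {N : ℕ} (v : Fin N → ZMod 2) :
    ∃ x ⊆ range N, indicatorVector N x = v := by
  refine ⟨{i ∈ range N | ∃ h : i < N, v ⟨i, h⟩ ≠ 0}, filter_subset _ _, ?_⟩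
  have h01 : ∀ b : ZMod 2, (if b ≠ 0 then 1 else 0) = b := by decide
  funext i
  rw [← h01 (v i)]
  refine if_congr ?_ rfl rfl
  simp

/-- Since there are as many vertices and edges as nonzero vectors, it suffices that every nonzero
vector is used as a label. -/
theorem isSetSequential_of_cover {V : Type*} [Fintype V] {G : SimpleGraph V} {N : ℕ}
    (hcard : Fintype.card V + Nat.card G.edgeSet + 1 = 2 ^ N) (f : V → Finset ℕ)
    (hf : ∀ x ⊆ range N, x.Nonempty → (∃ v, f v = x) ∨ ∃ v w, G.Adj v w ∧ f v ∆ f w = x) :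
    G.IsSetSequential := by
  classical
  let g : V → Fin N → ZMod 2 := fun v => indicatorVector N (f v)
  -- With the value `0` added, the labeling is a surjection between sets of equal size.
  let L : Option (V ⊕ G.edgeSet) → Fin N → ZMod 2 := fun o => o.elim 0 (inducedLabeling G g)
  have hsurj : Function.Surjective L := by
    intro v
    obtain ⟨x, hx, rfl⟩ := exists_indicatorVector_eq v
    rcases x.eq_empty_or_nonempty with rfl | hne
    · refine ⟨none, ?_⟩
      funext i
      simp [L, indicatorVector]
    rcases hf x hx hne with ⟨v, rfl⟩ | ⟨v, w, hvw, rfl⟩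
    · exact ⟨some (Sum.inl v), rfl⟩
    · refine ⟨some (Sum.inr ⟨s(v, w), hvw⟩), ?_⟩
      rw [indicatorVector_symmDiff]
      rfl
  have hbij : Function.Bijective L := by
    rw [Fintype.bijective_iff_surjective_and_card]
    refine ⟨hsurj, ?_⟩
    rw [Fintype.card_option, Fintype.card_sum, ← Nat.card_eq_fintype_card (α := G.edgeSet), hcard]
    simp
  have hinj : Function.Injective (inducedLabeling G g) := fun p q hpq =>
    Option.some_injective _ (hbij.1 (a₁ := some p) (a₂ := some q) hpq)
  refine ⟨N, g, fun v w hvw => ?_, fun v hv => ?_, fun x hx => ?_⟩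
  · exact Sum.inl_injective (hinj (a₁ := Sum.inl v) (a₂ := Sum.inl w) hvw)
  · exact Option.some_ne_none _ (hbij.1 (a₁ := some (Sum.inl v)) (a₂ := none) hv)
  · obtain ⟨o, rfl⟩ := hbij.2 x
    rcases o with _ | p
    · exact absurd rfl hx
    · exact ⟨p, rfl, fun q hq => hinj hq⟩

/-- The labeling read off from a matching of the cube. The spine vertex `σ t` gets the label `{t}`,
and the other children of `σ t` get representatives of the edges in direction `t` that are not
taken up by the spine. The vertices `x` of the cube with `D x ∉ x` represent the edges of the
matching; among these `∅` stands for the root and `{u}` for the spine vertex `σ u`. -/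
theorem isSetSequential_of_matching {V : Type*} [Fintype V] {G : SimpleGraph V} {K n : ℕ}
    (hK : 1 ≤ K) (hKn : K ≤ n) {σ : ℕ → V} (hσ : Set.InjOn σ (range K)) {p : ℕ → ℕ}
    (hp0 : p 0 = 0) (hp : ∀ t, 1 ≤ t → p t < t) {π : V → V} (hπσ : ∀ t < K, π (σ t) = σ (p t))
    (hadj : ∀ w, w ≠ σ 0 → G.Adj w (π w)) {D : Finset ℕ → ℕ}
    {a : ℕ → ℕ} (hD : Realizes (range (n + 1)) D a) (hD0 : D ∅ = 0)
    (hDs : ∀ t, 1 ≤ t → t < K → D {t} = p t) (ha0 : ∀ t, K ≤ t → a t = 0)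
    (ha : ∀ t < K, Nat.card {w // π w = σ t} = 2 * a t)
    (hcard : Fintype.card V + Nat.card G.edgeSet + 1 = 2 ^ (n + 1)) : G.IsSetSequential := by
  classical
  have hσinj : ∀ t < K, ∀ u < K, σ t = σ u → t = u := fun t ht u hu h =>
    hσ (mem_coe.2 (mem_range.2 ht)) (mem_coe.2 (mem_range.2 hu)) h
  have hpK : ∀ t < K, p t < K := fun t ht => by
    rcases Nat.eq_zero_or_pos t with rfl | h
    · omega
    · have := hp t h; omega
  have hDK : ∀ x ⊆ range (n + 1), D x < K := fun x hx => by
    by_contra! hcon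
    have h1 := hD.2 (D x)
    rw [ha0 _ hcon, directionCount, mul_zero, card_eq_zero] at h1
    have : x ∈ ({y ∈ (range (n + 1)).powerset | D y = D x} : Finset (Finset ℕ)) :=
      mem_filter.2 ⟨mem_powerset.2 hx, rfl⟩
    rw [h1] at this
    exact notMem_empty _ this
  let A : ℕ → Finset (Finset ℕ) := fun t => {x ∈ (range (n + 1)).powerset | D x = t ∧ t ∉ x}
  let idx : V → ℕ := Function.invFunOn σ (range K : Set ℕ)
  have hidx : ∀ t < K, idx (σ t) = t := fun t ht =>
    hσ.leftInvOn_invFunOn (mem_coe.2 (mem_range.2 ht))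
  let τ : ℕ → Finset ℕ := fun t => if t = 0 then ∅ else {t}
  have hτ : Function.Injective τ := by
    intro t u h
    simp only [τ] at h
    split_ifs at h with h1 h2 h2
    · omega
    · exact absurd h (singleton_ne_empty u).symm
    · exact absurd h (singleton_ne_empty t)
    · exact singleton_injective h
  have hτA : ∀ u < K, τ u ∈ A (p u) := by
    intro u hu
    simp only [A, τ, mem_filter, mem_powerset]
    split_ifs with h
    · subst h
      exact ⟨empty_subset _, by rw [hD0, hp0], notMem_empty _⟩
    · have h1 := hp u (by omega)
      refine ⟨?_, hDs u (by omega) hu, by rw [mem_singleton]; omega⟩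
      rw [singleton_subset_iff, mem_range]
      omega
  have hψ : ∀ t < K, ∃ ψ : V → Finset ℕ, (∀ x ∈ A t, ∃ w, π w = σ t ∧ ψ w = x) ∧
      ∀ u < K, p u = t → ψ (σ u) = τ u := by
    intro t ht
    have hAcard : Fintype.card {w // π w = σ t} = #(A t) := by
      have h1 := two_mul_card_filter_notMem hD.1 t
      have h2 : 2 * #(A t) = directionCount (range (n + 1)) D t := h1
      rw [hD.2] at h2
      have h3 := ha t ht
      rw [Nat.card_eq_fintype_card] at h3
      omega
    have hspine : ∀ w : {w // π w = σ t}, (∃ u < K, σ u = w) → ∃ u < K, σ u = w ∧ p u = t := by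
      rintro ⟨w, hw⟩ ⟨u, hu, rfl⟩
      refine ⟨u, hu, rfl, hσinj _ (hpK u hu) _ ht ?_⟩
      rw [← hπσ u hu, hw]
    obtain ⟨g, hg⟩ := Set.MapsTo.exists_equiv_extend_of_card_eq hAcard
      (s := {w | ∃ u < K, σ u = w}) (f := fun w => τ (idx w)) (fun w hw => by
        obtain ⟨u, hu, huw, hpu⟩ := hspine w hw
        simp only [← huw, hidx u hu, mem_coe]
        rw [← hpu]
        exact hτA u hu) (fun w hw w' hw' h => by
        obtain ⟨u, hu, huw, -⟩ := hspine w hw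
        obtain ⟨u', hu', huw', -⟩ := hspine w' hw'
        have h := hτ h
        rw [← huw, ← huw', hidx u hu, hidx u' hu'] at h
        exact Subtype.ext (by rw [← huw, ← huw', h]))
    refine ⟨fun w => if h : π w = σ t then g ⟨w, h⟩ else ∅, fun x hx => ?_, fun u hu hpu => ?_⟩
    · refine ⟨g.symm ⟨x, hx⟩, (g.symm ⟨x, hx⟩).2, ?_⟩
      dsimp only
      rw [dif_pos (g.symm ⟨x, hx⟩).2]
      simp
    · have h : π (σ u) = σ t := by rw [hπσ u hu, hpu]
      dsimp only
      rw [dif_pos h, hg ⟨σ u, h⟩ ⟨u, hu, rfl⟩]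
      simp only [hidx u hu]
  choose! ψ hψsurj hψspine using hψ
  let f : V → Finset ℕ := fun w => if w = σ 0 then {0} else ψ (idx (π w)) w
  have hfσ : ∀ u < K, f (σ u) = {u} := by
    intro u hu
    by_cases h : u = 0
    · subst h
      exact if_pos rfl
    · have h1 : σ u ≠ σ 0 := fun h' => h (hσinj u hu 0 (by omega) h')
      have h2 : f (σ u) = ψ (p u) (σ u) := by
        simp only [f, if_neg h1, hπσ u hu, hidx _ (hpK u hu)]
      rw [h2, hψspine _ (hpK u hu) u hu rfl]
      exact if_neg h
  have hcover : ∀ x ⊆ range (n + 1), D x ∉ x →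
      (x = ∅ ∧ D x = 0) ∨ ∃ w, w ≠ σ 0 ∧ π w = σ (D x) ∧ f w = x := by
    intro x hx hnot
    obtain ⟨w, hw, hwx⟩ := hψsurj (D x) (hDK x hx) x
      (mem_filter.2 ⟨mem_powerset.2 hx, rfl, hnot⟩)
    by_cases hw0 : w = σ 0
    · left
      have h1 : 0 < K := by omega
      have h2 : p 0 = D x := by
        refine hσinj _ (hpK 0 h1) _ (hDK x hx) ?_
        rw [← hπσ 0 h1, ← hw0, hw]
      have h3 := hψspine (D x) (hDK x hx) 0 h1 h2
      rw [← hw0, hwx] at h3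
      exact ⟨h3, by omega⟩
    · right
      refine ⟨w, hw0, hw, ?_⟩
      simp only [f, if_neg hw0, hw, hidx _ (hDK x hx), hwx]
  refine isSetSequential_of_cover hcard f fun x hx hne => ?_
  by_cases hmem : D x ∈ x
  · have hyx : x ∆ {D x} ⊆ range (n + 1) := symmDiff_singleton_subset hx (hD.1.mem x hx)
    have hyD := hD.1.symm x hx
    have hback : (x ∆ {D x}) ∆ {D x} = x := symmDiff_symmDiff_cancel_right _ _
    have hynot : D (x ∆ {D x}) ∉ x ∆ {D x} := by
      rw [hyD]
      simp [mem_symmDiff, hmem]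
    rcases hcover _ hyx hynot with ⟨hy, hDy⟩ | ⟨w, hw0, hw, hfw⟩
    · left
      refine ⟨σ 0, ?_⟩
      rw [hfσ 0 (by omega), ← hback, hy, ← hyD, hDy]
      exact (bot_symmDiff _).symm
    · right
      refine ⟨w, π w, hadj w hw0, ?_⟩
      rw [hw, hyD, hfσ _ (hDK x hx), hfw, hback]
  · left
    rcases hcover x hx hmem with ⟨h, -⟩ | ⟨w, -, -, hw⟩
    · exact absurd h hne.ne_empty
    · exact ⟨w, hw⟩

end Labeling

/-! ### The spine of a caterpillar -/

section Caterpillar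

open SimpleGraph

variable {V : Type*} {G : SimpleGraph V}

namespace SimpleGraph

/-- A spine of `G`: a path such that every vertex off the path is a leaf attached to the path. -/
def IsSpine {u v : V} (p : G.Walk u v) : Prop :=
  p.IsPath ∧ ∀ w ∉ p.support, ∃ x ∈ p.support, G.Adj w x ∧ ∀ y, G.Adj w y → y = x

theorem IsSpine.reverse {u v : V} {p : G.Walk u v} (hp : IsSpine p) : IsSpine p.reverse := by
  refine ⟨hp.1.reverse, fun w hw => ?_⟩
  simpa using hp.2 w (by simpa using hw)

theorem Walk.exists_isPath_support_subset {u v : V} (p : G.Walk u v) {x y : V}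
    (hx : x ∈ p.support) (hy : y ∈ p.support) :
    ∃ q : G.Walk x y, q.IsPath ∧ q.support ⊆ p.support := by
  classical
  refine ⟨((p.takeUntil x hx).reverse.append (p.takeUntil y hy)).bypass, Walk.bypass_isPath _,
    fun z hz => ?_⟩
  replace hz := Walk.support_bypass_subset_support _ hz
  rw [Walk.mem_support_append_iff, Walk.support_reverse, List.mem_reverse] at hz
  rcases hz with h | h
  · exact p.support_takeUntil_subset_support hx h
  · exact p.support_takeUntil_subset_support hy h

theorem IsTree.isSpine_of_dominating (hG : G.IsTree) {u v : V} {p : G.Walk u v} (hp : p.IsPath)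
    (hdom : ∀ w : V, ∃ x ∈ p.support, G.dist w x ≤ 1) : IsSpine p := by
  have hnbr : ∀ w ∉ p.support, ∃ x ∈ p.support, G.Adj w x := by
    intro w hw
    obtain ⟨x, hx, hd⟩ := hdom w
    refine ⟨x, hx, dist_eq_one_iff_adj.1 ?_⟩
    have hne : w ≠ x := fun h => hw (h ▸ hx)
    have := hG.connected.pos_dist_of_ne hne
    omega
  refine ⟨hp, fun w hw => ?_⟩
  obtain ⟨x, hx, hwx⟩ := hnbr w hw
  refine ⟨x, hx, hwx, fun y hwy => ?_⟩
  by_cases hy : y ∈ p.support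
  · obtain ⟨q, hq, hqp⟩ := p.exists_isPath_support_subset hx hy
    have hpath : (Walk.cons hwx q).IsPath := hq.cons fun h => hw (hqp h)
    simpa using hG.isAcyclic.eq_snd_of_adj_start hpath hwy (Walk.end_mem_support _)
  · obtain ⟨z, hz, hyz⟩ := hnbr y hy
    obtain ⟨q, hq, hqp⟩ := p.exists_isPath_support_subset hx hz
    have hpath : (Walk.cons hwx q).IsPath := hq.cons fun h => hw (hqp h)
    have hwz : w ≠ z := fun h => hw (h ▸ hz)
    have hpath' : (Walk.cons hwy (Walk.cons hyz Walk.nil)).IsPath := by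
      simp [Walk.cons_isPath_iff, hwy.ne, hyz.ne, hwz]
    have := (hG.existsUnique_path w z).unique hpath hpath'
    simpa using (congrArg Walk.snd this).symm

/-- An end of a shortest spine has a neighbor off the spine, as otherwise it could be dropped. -/
theorem IsSpine.exists_adj_notMem (hG : G.IsTree) {u v : V} {p : G.Walk u v} (hp : IsSpine p)
    (hpos : 0 < p.length)
    (hmin : ∀ (u' v' : V) (q : G.Walk u' v'), IsSpine q → p.length ≤ q.length) :
    ∃ y ∉ p.support, G.Adj u y := by
  by_contra! hcon
  cases p with
  | nil => simp at hpos
  | @cons _ x _ h q =>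
    have hq := (Walk.cons_isPath_iff h q).1 hp.1
    have hspine : IsSpine q := by
      refine ⟨hq.1, fun w hw => ?_⟩
      by_cases hwu : w = u
      · subst hwu
        refine ⟨x, q.start_mem_support, h, fun y hy => ?_⟩
        have hmem : y ∈ (Walk.cons h q).support := by
          by_contra hmem
          exact hcon y hmem hy
        simpa using hG.isAcyclic.eq_snd_of_adj_start hp.1 hy hmem
      · have hw' : w ∉ (Walk.cons h q).support := by
          rw [Walk.support_cons, List.mem_cons]
          rintro (h' | h')
          · exact hwu h'
          · exact hw h'
        obtain ⟨z, hz, hwz, huniq⟩ := hp.2 w hw'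
        refine ⟨z, ?_, hwz, huniq⟩
        rw [Walk.support_cons, List.mem_cons] at hz
        rcases hz with rfl | hz
        · exact absurd hwz.symm (hcon w hw')
        · exact hz
    have := hmin _ _ q hspine
    rw [Walk.length_cons] at this
    omega

/-- A shortest spine is shorter than the diameter by two, unless it is a single vertex. -/
theorem IsCaterpillar.exists_isSpine [Finite V] (hG : G.IsCaterpillar) :
    ∃ (u v : V) (p : G.Walk u v), IsSpine p ∧ (p.length = 0 ∨ p.length + 2 ≤ G.diam) := by
  classical
  obtain ⟨htree, u₀, v₀, p₀, hp₀, hdom⟩ := hG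
  have hex : ∃ l, ∃ (u v : V) (p : G.Walk u v), IsSpine p ∧ p.length = l :=
    ⟨_, u₀, v₀, p₀, htree.isSpine_of_dominating hp₀ hdom, rfl⟩
  obtain ⟨u, v, p, hp, hl⟩ := Nat.find_spec hex
  have hmin : ∀ (u' v' : V) (q : G.Walk u' v'), IsSpine q → p.length ≤ q.length :=
    fun u' v' q hq => hl ▸ Nat.find_min' hex ⟨u', v', q, hq, rfl⟩
  refine ⟨u, v, p, hp, ?_⟩
  rcases Nat.eq_zero_or_pos p.length with h0 | hpos
  · exact Or.inl h0
  right
  obtain ⟨y, hy, huy⟩ := hp.exists_adj_notMem htree hpos hmin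
  obtain ⟨z, hz, hvz⟩ := hp.reverse.exists_adj_notMem htree (by simpa using hpos)
    (fun u' v' q hq => by simpa using hmin u' v' q hq)
  rw [Walk.support_reverse, List.mem_reverse] at hz
  have huv : u ≠ v := by
    rintro rfl
    have := Walk.isPath_iff_nil.1 hp.1
    rw [← Walk.length_eq_zero_iff] at this
    omega
  have hyz : y ≠ z := by
    rintro rfl
    obtain ⟨x, _, _, hx⟩ := hp.2 y hy
    exact huv ((hx u huy.symm).trans (hx v hvz.symm).symm)
  have hpath : (Walk.cons huy.symm (p.concat hvz)).IsPath := by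
    refine (hp.1.concat hz hvz).cons ?_
    rw [Walk.support_concat, List.mem_append, List.mem_singleton]
    rintro (h | h)
    · exact hy h
    · exact hyz h
  obtain ⟨q, hq, hqd⟩ := htree.connected.exists_path_of_dist y z
  have heq := (htree.existsUnique_path y z).unique hpath hq
  have hlen := congrArg Walk.length heq
  rw [Walk.length_cons, Walk.length_concat, hqd] at hlen
  have := htree.connected.nonempty
  have hdiam := dist_le_diam (connected_iff_ediam_ne_top.1 htree.connected) (u := y) (v := z)
  omega

/-- In a tree with parent function `π` towards the root `s`, where `π s = s`, the number of
preimages of a vertex under `π` is its degree less one, and at the root its degree plus one. -/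
theorem IsTree.card_fiber_parent [Fintype V] [DecidableEq V] [DecidableRel G.Adj] (hG : G.IsTree)
    {s : V} {π : V → V} (hs : π s = s) (hadj : ∀ w, w ≠ s → G.Adj w (π w))
    (hno : ∀ w, w ≠ s → π (π w) ≠ w) (v : V) :
    (v = s ∧ #{w | π w = v} = G.degree v + 1) ∨ (v ≠ s ∧ #{w | π w = v} + 1 = G.degree v) := by
  -- Edges and non-root vertices are equally many, so every edge joins a vertex to its parent.
  let e : {w : V // w ≠ s} → G.edgeSet := fun w => ⟨s(w.1, π w.1), hadj w.1 w.2⟩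
  have hinj : Function.Injective e := by
    rintro ⟨w, hw⟩ ⟨w', hw'⟩ h
    have h := congrArg Subtype.val h
    rcases Sym2.eq_iff.1 h with ⟨h1, _⟩ | ⟨h1, h2⟩
    · exact Subtype.ext h1
    · dsimp only at h1 h2
      rw [h1] at h2
      exact absurd h2 (hno w' hw')
  have hcard : Fintype.card {w : V // w ≠ s} = Fintype.card G.edgeSet := by
    have h1 := hG.card_edgeFinset
    rw [edgeFinset_card] at h1
    rw [Fintype.card_subtype_compl, Fintype.card_subtype_eq]
    omega
  have hsurj := ((Fintype.bijective_iff_injective_and_card e).2 ⟨hinj, hcard⟩).2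
  have hedge : ∀ x y, G.Adj x y → (x ≠ s ∧ π x = y) ∨ (y ≠ s ∧ π y = x) := by
    intro x y hxy
    obtain ⟨⟨w, hw⟩, h⟩ := hsurj ⟨s(x, y), hxy⟩
    have h := congrArg Subtype.val h
    rcases Sym2.eq_iff.1 h with ⟨h1, h2⟩ | ⟨h1, h2⟩
    · dsimp only at h1 h2
      subst h1
      exact Or.inl ⟨hw, h2⟩
    · dsimp only at h1 h2
      subst h1
      exact Or.inr ⟨hw, h2⟩
  rw [← card_neighborFinset_eq_degree]
  by_cases hv : v = s
  · left
    refine ⟨hv, ?_⟩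
    subst hv
    have : ({w | π w = v} : Finset V) = insert v (G.neighborFinset v) := by
      ext w
      simp only [mem_filter, mem_univ, true_and, mem_insert, mem_neighborFinset]
      constructor
      · intro h
        by_cases hw : w = v
        · exact Or.inl hw
        · exact Or.inr (h ▸ (hadj w hw).symm)
      · rintro (rfl | h)
        · exact hs
        · rcases hedge _ _ h with ⟨h1, _⟩ | ⟨_, h2⟩
          · exact absurd rfl h1
          · exact h2
    rw [this, card_insert_of_notMem (by simp)]
  · right
    refine ⟨hv, ?_⟩
    have : G.neighborFinset v = insert (π v) ({w | π w = v} : Finset V) := by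
      ext w
      simp only [mem_filter, mem_univ, true_and, mem_insert, mem_neighborFinset]
      constructor
      · intro h
        rcases hedge _ _ h with ⟨_, h2⟩ | ⟨_, h2⟩
        · exact Or.inl h2.symm
        · exact Or.inr h2
      · rintro (rfl | rfl)
        · exact hadj v hv
        · refine (hadj w ?_).symm
          rintro rfl
          exact hv hs
    rw [this, card_insert_of_notMem]
    simp only [mem_filter, mem_univ, true_and]
    exact hno v hv

/-- A spine, enumerated from a vertex of maximal degree, first along one branch and then, from
position `c` on, along the other one. -/
theorem IsSpine.exists_enumeration [Fintype V] [DecidableRel G.Adj] {u v : V} {q : G.Walk u v}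
    (hq : IsSpine q) : ∃ (c : ℕ) (σ : ℕ → V), Set.InjOn σ (range (q.length + 1)) ∧
      (∀ t, 1 ≤ t → t < q.length + 1 → G.Adj (σ t) (σ (if t = c then 0 else t - 1))) ∧
      (∀ w ∈ q.support, ∃ t < q.length + 1, σ t = w) ∧
      (∀ t < q.length + 1, σ t ∈ q.support) ∧
      ∀ t < q.length + 1, G.degree (σ t) ≤ G.degree (σ 0) := by
  obtain ⟨s, hs, hmax⟩ := exists_max_image (range (q.length + 1)) (fun i => G.degree (q.getVert i))
    ⟨0, by simp⟩
  rw [mem_range] at hs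
  have hinj := hq.1.getVert_injOn
  have hadj : ∀ i j, j = i + 1 → j ≤ q.length → G.Adj (q.getVert j) (q.getVert i) := by
    rintro i _ rfl hi
    exact (q.adj_getVert_succ (by omega)).symm
  refine ⟨q.length + 1 - s, fun t => q.getVert
    (if t < q.length + 1 - s then s + t else q.length - t), ?_, ?_, ?_, ?_, ?_⟩
  · intro t ht t' ht' h
    rw [mem_coe, mem_range] at ht ht'
    have := hinj (by rw [Set.mem_ofPred_eq]; split_ifs <;> omega)
      (by rw [Set.mem_ofPred_eq]; split_ifs <;> omega) h
    split_ifs at this <;> omega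
  · intro t h1 h2
    dsimp only
    rcases lt_trichotomy t (q.length + 1 - s) with h | h | h
    · rw [if_pos h, if_neg h.ne, if_pos (by omega)]
      exact hadj _ _ (by omega) (by omega)
    · rw [if_neg h.not_lt, if_pos h, if_pos (by omega)]
      exact (hadj _ _ (by omega) (by omega)).symm
    · rw [if_neg h.not_gt, if_neg h.ne', if_neg (by omega)]
      exact (hadj _ _ (by omega) (by omega)).symm
  · intro w hw
    obtain ⟨i, rfl, hi⟩ := Walk.mem_support_iff_exists_getVert.1 hw
    rcases Nat.lt_or_ge i s with h | h
    · refine ⟨q.length - i, by omega, ?_⟩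
      dsimp only
      rw [if_neg (by omega)]
      congr 1
      omega
    · refine ⟨i - s, by omega, ?_⟩
      dsimp only
      rw [if_pos (by omega)]
      congr 1
      omega
  · intro t _
    exact q.getVert_mem_support _
  · intro t ht
    have hle : ∀ x, x = q.getVert s →
        G.degree (q.getVert (if t < q.length + 1 - s then s + t else q.length - t)) ≤
          G.degree x := by
      rintro _ rfl
      exact hmax _ (mem_range.2 (by split_ifs <;> omega))
    exact hle _ (by dsimp only; rw [if_pos (by omega), add_zero])

end SimpleGraph

end Caterpillar

/-! ### Caterpillars are set-sequential -/

theorem mainTheorem2 {V : Type*} [Fintype V] (G : SimpleGraph V) [DecidableRel G.Adj] (k n : ℕ)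
    (hcat : G.IsCaterpillar) (hdiam : G.diam = k + 1)
    (hodd : ∀ v : V, Odd (G.degree v))
    (hlarge : 2 ^ k ≤ Fintype.card V) (hcard : Fintype.card V = 2 ^ n) :
    G.IsSetSequential := by
  classical
  have htree := hcat.1
  obtain ⟨u, v, q, hq, hlen⟩ := hcat.exists_isSpine
  obtain ⟨c, σ, hσ, hσadj, hσsurj, hσmem, hσdeg⟩ := hq.exists_enumeration
  set K := q.length + 1 with hKdef
  have hK : 1 ≤ K := by omega
  have hKn : K ≤ n := by
    have hkn : k ≤ n := by
      rw [hcard] at hlarge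
      exact (Nat.pow_le_pow_iff_right (by omega)).1 hlarge
    have hn : n ≠ 0 := by
      rintro rfl
      have hnt := SimpleGraph.nontrivial_of_diam_ne_zero (G := G) (by omega)
      have := Fintype.one_lt_card_iff_nontrivial.2 hnt
      omega
    omega
  let p : ℕ → ℕ := fun t => if t = c then 0 else t - 1
  have hpdef : ∀ t, p t = if t = c then 0 else t - 1 := fun _ => rfl
  have hp0 : p 0 = 0 := by rw [hpdef]; split_ifs <;> rfl
  have hp : ∀ t, 1 ≤ t → p t < t := fun t ht => by rw [hpdef]; split_ifs <;> omega
  have hpK : ∀ t < K, p t < K := fun t ht => by rw [hpdef]; split_ifs <;> omega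
  have hσinj : ∀ t < K, ∀ t' < K, σ t = σ t' → t = t' := fun t ht t' ht' h =>
    hσ (mem_coe.2 (mem_range.2 ht)) (mem_coe.2 (mem_range.2 ht')) h
  -- The parent function of the tree, rooted at the spine vertex `σ 0` of largest degree.
  have hπex : ∀ w, ∃ x, (∀ t < K, w = σ t → x = σ (p t)) ∧ (∃ t < K, x = σ t) ∧
      (w ≠ σ 0 → G.Adj w x) := by
    intro w
    by_cases hw : w ∈ q.support
    · obtain ⟨t, ht, rfl⟩ := hσsurj w hw
      refine ⟨σ (p t), fun t' ht' h => by rw [hσinj t ht t' ht' h], ⟨p t, hpK t ht, rfl⟩,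
        fun h => ?_⟩
      exact hσadj t (Nat.one_le_iff_ne_zero.2 fun h' => h (by rw [h'])) ht
    · obtain ⟨x, hx, hwx, -⟩ := hq.2 w hw
      obtain ⟨t, ht, rfl⟩ := hσsurj x hx
      exact ⟨σ t, fun t' ht' h => absurd (h ▸ hσmem t' ht') hw, ⟨t, ht, rfl⟩, fun _ => hwx⟩
  choose π hπσ' hπ hπadj using hπex
  have hπσ : ∀ t < K, π (σ t) = σ (p t) := fun t ht => hπσ' _ t ht rfl
  have hno : ∀ w, w ≠ σ 0 → π (π w) ≠ w := by
    intro w hw h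
    obtain ⟨t, ht, hwt⟩ : ∃ t < K, w = σ t := h ▸ hπ (π w)
    subst hwt
    rw [hπσ t ht, hπσ _ (hpK t ht)] at h
    have h1 := hσinj _ (hpK _ (hpK t ht)) _ ht h
    have ht0 : 1 ≤ t := Nat.one_le_iff_ne_zero.2 fun h' => hw (by rw [h'])
    have h2 := hp t ht0
    rcases Nat.eq_zero_or_pos (p t) with h3 | h3
    · rw [h3, hp0] at h1
      omega
    · have h4 := hp (p t) h3
      omega
  have hfib := htree.card_fiber_parent (by rw [hπσ 0 hK, hp0]) hπadj hno
  have heven : ∀ v, Even #{w | π w = v} := by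
    intro v
    have h1 := hodd v
    rw [Nat.even_iff]
    rw [Nat.odd_iff] at h1
    rcases hfib v with ⟨_, h⟩ | ⟨_, h⟩ <;> omega
  let a : ℕ → ℕ := fun t => if t < K then #{w | π w = σ t} / 2 else 0
  have ha : ∀ t < K, #{w | π w = σ t} = 2 * a t := fun t ht => by
    have := Nat.even_iff.1 (heven (σ t))
    simp only [a, ht, if_true]
    omega
  have ha0 : ∀ t, K ≤ t → a t = 0 := fun t ht => if_neg (by omega)
  have hsum : 4 * ∑ t ∈ range K, a t = 2 ^ (n + 1) := by
    have h1 : Fintype.card V = ∑ x ∈ (range K).image σ, #{w | π w = x} :=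
      card_eq_sum_card_fiberwise fun w _ => by
        obtain ⟨t, ht, h⟩ := hπ w
        rw [h]
        exact mem_image_of_mem _ (mem_range.2 ht)
    rw [sum_image hσ, sum_congr rfl fun t ht => ha t (mem_range.1 ht), ← mul_sum, hcard] at h1
    rw [pow_succ]
    omega
  have hmax : ∀ t, a t ≤ a 0 := by
    intro t
    rcases Nat.lt_or_ge t K with ht | ht
    · have h1 := ha t ht
      have h2 := ha 0 hK
      have h3 := hσdeg t ht
      rcases hfib (σ 0) with ⟨_, h4⟩ | ⟨h4, _⟩
      · rcases hfib (σ t) with ⟨_, h5⟩ | ⟨_, h5⟩ <;> omega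
      · exact absurd rfl h4
    · rw [ha0 t ht]
      exact Nat.zero_le _
  have hch : ∀ i, #{t ∈ range K | p t = i} ≤ 2 * a i := by
    intro i
    rcases Nat.lt_or_ge i K with hi | hi
    · rw [← ha i hi]
      refine card_le_card_of_injOn σ (fun t ht => ?_) fun t ht t' ht' h => ?_
      · rw [mem_coe, mem_filter, mem_range] at ht
        simp only [coe_filter, mem_univ, true_and, Set.mem_ofPred_eq]
        rw [hπσ t ht.1, ht.2]
      · rw [mem_coe, mem_filter, mem_range] at ht ht'
        exact hσinj t ht.1 t' ht'.1 h
    · rw [filter_false_of_mem, card_empty]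
      · exact Nat.zero_le _
      · intro t ht h
        have := hpK t (mem_range.1 ht)
        omega
  obtain ⟨D, hD, hD0, hDs⟩ := exists_spine_matching hK hKn hpdef ha0 hsum hmax hch
  refine isSetSequential_of_matching hK hKn hσ hp0 hp hπσ hπadj hD hD0 hDs ha0
    (fun t ht => ?_) ?_
  · rw [← ha t ht, Nat.card_eq_fintype_card, Fintype.card_subtype]
  · have h1 := htree.card_edgeFinset
    rw [SimpleGraph.edgeFinset_card, ← Nat.card_eq_fintype_card] at h1
    rw [pow_succ]
    omega
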